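/- **Setting.** Let $(M,G)$ be a four-dimensional area metric manifold, i.e. a smooth 4-manifold $M$ with a smooth covariant rank-four tensor field $G$ such that $G(X,Y,A,B)=G(A,B,X,Y)=-G(Y,X,A,B)$ and such that $X\wedge Y\mapsto\big(A\wedge B\mapsto G(X,Y,A,B)\big)$ is an invertible map $\Lambda^2T_pM\to\Lambda^2T^*_pM$ at each point $p$. In a frame $(e_a)_{a=0,\dots,3}$ of $T_pM$, let $\mathrm{Petrov}(G)$ be the symmetric $6\times6$ matrix of the components $G_{abcd}$ with respect to the index pairs $[01],[02],[03],[12],[31],[23]$. Let $G^{abcd}$ be the components of the inverse area metric, whose Petrov matrix is $\mathrm{Petrov}(G)^{-1}$, and let $(\omega_G)_{abcd}=|\det\mathrm{Petrov}(G)|^{1/6}\epsilon_{abcd}$ with $\epsilon_{0123}=1$. The Fresnel tensor is the totally symmetric tensor $$\mathcal G^{abcd}=-\tfrac1{24}(\omega_G)_{mnpq}(\omega_G)_{rstu}\,G^{mnr(a}G^{b|ps|c}G^{d)qtu},$$ and the characteristic polynomial on $T_p^*M$ is $P(k)=-|\det\mathrm{Petrov}(G)|^{-1/3}\,\mathcal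 G(k,k,k,k)$. A covector $k\in T^*_pM$ is timelike if $P(k)\neq0$ and, for every $\eta\in T_p^*M$, all complex roots $\lambda$ of $P(\eta-\lambda k)$ are real. Let $\tau$ be a time orientation, i.e. a smooth covector field that is timelike at every point. The future timelike covector cone is $$C_p^*=\{\xi\in T_p^*M:\ \text{every root }\lambda\text{ of }P(\xi-\lambda\tau_p)\text{ is positive}\},$$ and the cone $C_p$ of future timelike vectors is the interior of the dual cone $\{v\in T_pM: k(v)\ge0\text{ for all }k\in C_p^*\}$. **Theorem 2.1.** For every $p\in M$, the set $C_p^*$ is an open convex cone (closed under multiplication by positive reals). Suppose moreover that $C_p$ is non-empty. If $\mathcal G(\tau_p,\tau_p,\tau_p,\tau_p)>0$ (as it is for area metrics induced by Lorentzian metrics), then $$C_p^*\to C_p,\qquad k\mapsto\mathcal G(k,k,k,\cdot)$$ is a bijection. If instead $\mathcal G(\tau_p,\tau_p,\tau_p,\tau_p)<0$ (the only other possibility), then $k\mapsto-\mathcal G(k,k,k,\cdot)$ is a bijection $C_p^*\to C_p$. -/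

import Mathlib

open scoped Manifold ContDiff

noncomputable section

/-- An area metric on a real vector space: a fourth-rank covariant tensor with the pair symmetry,
the antisymmetry, and an invertible induced map `Λ²V → (Λ²V)*`, which sends `X ∧ Y` to the
functional `A ∧ B ↦ G(X, Y, A, B)`. -/
structure AreaMetric (V : Type*) [AddCommGroup V] [Module ℝ V] where
  form : V →ₗ[ℝ] V →ₗ[ℝ] V →ₗ[ℝ] V →ₗ[ℝ] ℝ
  pair_symm : ∀ X Y A B : V, form X Y A B = form A B X Y
  antisymm : ∀ X Y A B : V, form X Y A B = -form Y X A B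
  invertible : ∃ Ghat : (⋀[ℝ]^2 V) ≃ₗ[ℝ] Module.Dual ℝ (⋀[ℝ]^2 V), ∀ X Y A B : V,
    Ghat (exteriorPower.ιMulti ℝ 2 ![X, Y]) (exteriorPower.ιMulti ℝ 2 ![A, B]) = form X Y A B

namespace AreaMetric

/-- The ordered antisymmetric index pairs `[01], [02], [03], [12], [31], [23]`. -/
def petrovPair : Fin 6 → Fin 4 × Fin 4 :=
  ![(0, 1), (0, 2), (0, 3), (1, 2), (3, 1), (2, 3)]

/-- `1` if `(a, b)` is the `A`-th Petrov pair, `-1` if `(b, a)` is, and `0` otherwise. -/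
def petrovSign (A : Fin 6) (a b : Fin 4) : ℝ :=
  if petrovPair A = (a, b) then 1 else if petrovPair A = (b, a) then -1 else 0

section Frame

variable {V : Type*} [AddCommGroup V] [Module ℝ V]
  (G : AreaMetric V) (e : Module.Basis (Fin 4) ℝ V)

/-- The symmetric `6 × 6` matrix of an area metric in the frame `e`. -/
def petrov : Matrix (Fin 6) (Fin 6) ℝ :=
  Matrix.of fun A B =>
    G.form (e (petrovPair A).1) (e (petrovPair A).2) (e (petrovPair B).1) (e (petrovPair B).2)

/-- The components `G^{abcd}` of the inverse area metric in the frame `e`; its Petrov matrix is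
the inverse of the Petrov matrix of `G`. -/
def invComp (a b c d : Fin 4) : ℝ :=
  ∑ A : Fin 6, ∑ B : Fin 6, petrovSign A a b * (G.petrov e)⁻¹ A B * petrovSign B c d

/-- The canonical volume form `ω_G = |det Petrov(G)|^{1/6} ε`, oriented by the frame `e`. -/
def volumeForm : V [⋀^Fin 4]→ₗ[ℝ] ℝ :=
  (|(G.petrov e).det| ^ (1 / 6 : ℝ)) • e.det

/-- The components of the canonical volume form in the frame `e`. -/
def volComp (m n p q : Fin 4) : ℝ :=
  G.volumeForm e ![e m, e n, e p, e q]

/-- The contraction `-(1/24) ω_{mnpq} ω_{rstu} G^{mnra} G^{bpsc} G^{dqtu}`, not yet symmetrized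
in `a = i 0`, `b = i 1`, `c = i 2`, `d = i 3`. -/
def fresnelContraction (i : Fin 4 → Fin 4) : ℝ :=
  -(1 / 24) * ∑ m, ∑ n, ∑ p, ∑ q, ∑ r, ∑ s, ∑ t, ∑ u,
    G.volComp e m n p q * G.volComp e r s t u *
      (G.invComp e m n r (i 0) * G.invComp e (i 1) p s (i 2) * G.invComp e (i 3) q t u)

/-- The components `𝒢^{abcd}` of the totally symmetric Fresnel tensor in the frame `e`. -/
def fresnelComp (a b c d : Fin 4) : ℝ :=
  (1 / 24) * ∑ σ : Equiv.Perm (Fin 4), G.fresnelContraction e (![a, b, c, d] ∘ σ)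

/-- The Fresnel polynomial `𝒢(k, k, k, k)` as a polynomial in the components of `k`. -/
def fresnelPoly : MvPolynomial (Fin 4) ℝ :=
  ∑ a, ∑ b, ∑ c, ∑ d, MvPolynomial.C (G.fresnelComp e a b c d) *
    (MvPolynomial.X a * MvPolynomial.X b * MvPolynomial.X c * MvPolynomial.X d)

/-- The characteristic polynomial `P(k) = -|det Petrov(G)|^{-1/3} 𝒢(k, k, k, k)` of Maxwell
theory, as a polynomial in the components of `k`. -/
def charPoly : MvPolynomial (Fin 4) ℝ :=
  MvPolynomial.C (-(|(G.petrov e).det| ^ (-(1 / 3) : ℝ))) * G.fresnelPoly e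

end Frame

section Cones

variable {V : Type*} [AddCommGroup V] [Module ℝ V] [TopologicalSpace V]
  (G : AreaMetric V) (e : Module.Basis (Fin 4) ℝ V)

/-- The Fresnel tensor, evaluated on four covectors. -/
def fresnel (k l m n : V →L[ℝ] ℝ) : ℝ :=
  ∑ a, ∑ b, ∑ c, ∑ d, G.fresnelComp e a b c d * k (e a) * l (e b) * m (e c) * n (e d)

/-- The vector `𝒢(k, k, k, ·)`, under the identification of `V` with its double dual. -/
def fresnelMap (k : V →L[ℝ] ℝ) : V :=
  ∑ d, (∑ a, ∑ b, ∑ c, G.fresnelComp e a b c d * k (e a) * k (e b) * k (e c)) • e d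

/-- The value `P(k)` of the characteristic polynomial at a covector. -/
def charValue (k : V →L[ℝ] ℝ) : ℝ :=
  MvPolynomial.eval (fun a => k (e a)) (G.charPoly e)

/-- A covector `k` is timelike if `P(k) ≠ 0` and, for every covector `η`, all complex roots `z`
of `P(η - z k)` are real. -/
def IsTimelike (k : V →L[ℝ] ℝ) : Prop :=
  G.charValue e k ≠ 0 ∧ ∀ (η : V →L[ℝ] ℝ) (z : ℂ),
    MvPolynomial.aeval (fun a => (η (e a) : ℂ) - z * (k (e a) : ℂ)) (G.charPoly e) = 0 → z.im = 0

/-- The future timelike covector cone with respect to the timelike covector `τ`: all covectors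
`ξ` whose characteristic roots relative to `τ`, that is the roots `s` of `P(ξ - s τ)`, are
positive. These roots are all real when `τ` is timelike. -/
def futureCovectorCone (τ : V →L[ℝ] ℝ) : Set (V →L[ℝ] ℝ) :=
  {ξ | ∀ s : ℝ, G.charValue e (ξ - s • τ) = 0 → 0 < s}

/-- The open cone of future timelike vectors: the interior of the dual of the future timelike
covector cone. -/
def futureVectorCone (τ : V →L[ℝ] ℝ) : Set V :=
  interior {v | ∀ k ∈ G.futureCovectorCone e τ, 0 ≤ k v}

end Cones

end AreaMetric

section Manifold

variable (M : Type*) [TopologicalSpace M] [ChartedSpace (EuclideanSpace ℝ (Fin 4)) M]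
  [IsManifold (𝓡 4) ∞ M]

/-- `X` is a vector field on `M` that is smooth on `U`. -/
def IsSmoothVectorFieldOn (U : Set M) (X : ∀ p : M, TangentSpace (𝓡 4) p) : Prop :=
  ContMDiffOn (𝓡 4) (𝓡 4).tangent ∞ (fun p => (⟨p, X p⟩ : TangentBundle (𝓡 4) M)) U

/-- A smooth area metric on a four-dimensional manifold `M`: an area metric on each tangent space
whose value on any local smooth vector fields is a smooth function. -/
structure AreaMetricField where
  at_ : ∀ p : M, AreaMetric (TangentSpace (𝓡 4) p)
  smooth : ∀ (U : Set M), IsOpen U → ∀ X Y A B : (∀ p : M, TangentSpace (𝓡 4) p),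
    IsSmoothVectorFieldOn M U X → IsSmoothVectorFieldOn M U Y →
    IsSmoothVectorFieldOn M U A → IsSmoothVectorFieldOn M U B →
    ContMDiffOn (𝓡 4) 𝓘(ℝ, ℝ) ∞ (fun p => (at_ p).form (X p) (Y p) (A p) (B p)) U

variable {M}

/-- A smooth covector field. -/
def IsSmoothCovectorField (τ : ∀ p : M, TangentSpace (𝓡 4) p →L[ℝ] ℝ) : Prop :=
  ∀ (U : Set M), IsOpen U → ∀ X : (∀ p : M, TangentSpace (𝓡 4) p),
    IsSmoothVectorFieldOn M U X → ContMDiffOn (𝓡 4) 𝓘(ℝ, ℝ) ∞ (fun p => τ p (X p)) U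

/-- A time orientation: a smooth covector field that is timelike at every point. Whether a
covector is timelike does not depend on the frame in which it is tested. -/
def IsTimeOrientation (G : AreaMetricField M) (τ : ∀ p : M, TangentSpace (𝓡 4) p →L[ℝ] ℝ) : Prop :=
  IsSmoothCovectorField τ ∧
    ∀ (p : M) (e : Module.Basis (Fin 4) ℝ (TangentSpace (𝓡 4) p)), (G.at_ p).IsTimelike e (τ p)

end Manifold

end

/-! The theorem is Gårding's theory of hyperbolic polynomials applied to the quartic form
`𝒢(k,k,k,k)`. Up to a nonzero factor this form is `P`, so with `r` of the sign of `𝒢(τ,τ,τ,τ)` the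
polynomial `r𝒢` is hyperbolic in the direction `τ`, and the future covector cone is its
hyperbolicity cone `C`. By total symmetry the gradient of `(r/4)𝒢` is `r𝒢(k,k,k,·)`. It remains to
treat a hyperbolic form `p` of degree `d ≥ 2`.

Convexity: `C` is open, and `p` vanishes at the points of its closure outside `C`, so a connected
set that avoids the zeros of `p` and meets `C` lies in `C`. A homotopy of complex roots
(`IsHyperbolic.of_mem`) shows that `p` is hyperbolic in every direction of `C`, with the same cone.
A hyperbolicity cone is star-shaped about its direction, hence `C` is star-shaped about each of its
points.

Bijectivity: on the plane of `b ∈ C` and `x`, `p(tb + sx) = p(b) ∏ (t + s wᵢ)` with real `wᵢ`, so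
the gradient at `b` pairs with `x` to `p(b) ∑ wᵢ`. This is nonnegative on the closure of `C`. If it
vanishes, all `wᵢ` are zero and `C` contains an affine line in the direction `x`, which forces `x =
0` when the dual cone has interior. Compactness of the slices `v·k = 1` then puts the gradient in
the interior of the dual cone. For surjectivity, maximize `p` on the slice: the maximizer lies in
`C`, its gradient is a positive multiple of `v`, and homogeneity rescales it. For injectivity, equal
gradients at `b` and `x` give `∑ wᵢ = d ∏ wᵢ`. The inequality of arithmetic and geometric means,
used in both directions, makes every `wᵢ` equal to `1`, so `C` contains a line in the direction `x -
b`, and `x = b`. -/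

namespace MvPolynomial

/-! ### Restriction of a homogeneous polynomial to a line, and its complex factorization. -/

section Line

variable {ι R A : Type*} [CommSemiring R] [CommRing A] [Algebra R A] {p : MvPolynomial ι R} {d : ℕ}

theorem IsHomogeneous.aeval_smul (hp : p.IsHomogeneous d) (c : A) (x : ι → A) :
    MvPolynomial.aeval (c • x) p = c ^ d * MvPolynomial.aeval x p := by
  rw [aeval_def, aeval_def, eval₂_eq, eval₂_eq, Finset.mul_sum]
  refine Finset.sum_congr rfl fun m hm => ?_
  have hd : ∑ i ∈ m.support, m i = d := (hp.degree_eq_sum_deg_support hm).symm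
  simp only [Pi.smul_apply, smul_eq_mul, mul_pow, Finset.prod_mul_distrib,
    Finset.prod_pow_eq_pow_sum, hd]
  ring

/-- The restriction of `p` to the line through `x` in the direction `a`. -/
noncomputable def linePoly (p : MvPolynomial ι R) (x a : ι → A) : Polynomial A :=
  MvPolynomial.aeval (fun i => Polynomial.C (x i) + Polynomial.C (a i) * Polynomial.X) p

theorem eval_linePoly (x a : ι → A) (z : A) :
    (linePoly p x a).eval z = MvPolynomial.aeval (x + z • a) p := by
  rw [linePoly, ← Polynomial.coe_aeval_eq_eval]
  change (Polynomial.aeval (R := A) z).restrictScalars R _ = _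
  rw [comp_aeval_apply]
  congr 2
  ext i
  simp only [AlgHom.restrictScalars_apply, Polynomial.coe_aeval_eq_eval, Polynomial.eval_add,
    Polynomial.eval_mul, Polynomial.eval_C, Polynomial.eval_X, Pi.add_apply, Pi.smul_apply,
    smul_eq_mul, mul_comm]

theorem natDegree_line_le (b c : A) :
    (Polynomial.C b + Polynomial.C c * Polynomial.X).natDegree ≤ 1 := by
  compute_degree

theorem IsHomogeneous.natDegree_linePoly_le (hp : p.IsHomogeneous d) (x a : ι → A) :
    (linePoly p x a).natDegree ≤ d := by
  rw [linePoly, ← aeval_map_algebraMap A]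
  simpa using aeval_natDegree_le (n := 1) _ (hp.map (algebraMap R A)).totalDegree_le _
    fun i => natDegree_line_le (x i) (a i)

theorem _root_.Polynomial.coeff_prod_sum_of_natDegree_le {κ : Type*} (s : Finset κ)
    (f : κ → Polynomial A) (n : κ → ℕ) (h : ∀ i ∈ s, (f i).natDegree ≤ n i) :
    (∏ i ∈ s, f i).coeff (∑ i ∈ s, n i) = ∏ i ∈ s, (f i).coeff (n i) := by
  classical
  induction s using Finset.induction_on with
  | empty => simp
  | insert i s hi ih =>
    rw [Finset.prod_insert hi, Finset.sum_insert hi, Finset.prod_insert hi,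
      Polynomial.coeff_mul_add_eq_of_natDegree_le (h i (Finset.mem_insert_self i s)),
      ih fun j hj => h j (Finset.mem_insert_of_mem hj)]
    exact (Polynomial.natDegree_prod_le _ _).trans
      (Finset.sum_le_sum fun j hj => h j (Finset.mem_insert_of_mem hj))

/-- Each monomial has exactly `d` linear factors, so its coefficient in degree `d` collects only the
slopes `a i`. Hence `p(a) ≠ 0` makes the degree on the line exactly `d`. -/
theorem IsHomogeneous.coeff_linePoly (hp : p.IsHomogeneous d) (x a : ι → A) :
    (linePoly p x a).coeff d = MvPolynomial.aeval a p := by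
  rw [linePoly, aeval_def, aeval_def, eval₂_eq, eval₂_eq, Polynomial.finsetSum_coeff]
  refine Finset.sum_congr rfl fun m hm => ?_
  have hd : d = ∑ i ∈ m.support, m i := hp.degree_eq_sum_deg_support hm
  rw [IsScalarTower.algebraMap_apply R A (Polynomial A), Polynomial.algebraMap_eq,
    Polynomial.coeff_C_mul, hd, Polynomial.coeff_prod_sum_of_natDegree_le]
  · congr 1
    refine Finset.prod_congr rfl fun i _ => ?_
    have := Polynomial.coeff_pow_of_natDegree_le (m := m i) (natDegree_line_le (x i) (a i))
    rw [mul_one] at this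
    rw [this]
    simp
  · intro i _
    refine Polynomial.natDegree_pow_le.trans ?_
    exact (Nat.mul_le_mul_left _ (natDegree_line_le _ _)).trans (mul_one _).le

end Line

section Complex

variable {ι : Type*} {p : MvPolynomial ι ℝ} {d : ℕ}

theorem IsHomogeneous.exists_complex_factorization (hp : p.IsHomogeneous d) (x a : ι → ℂ)
    (ha : MvPolynomial.aeval a p ≠ 0) :
    ∃ m : Multiset ℂ, m.card = d ∧ (∀ w ∈ m, MvPolynomial.aeval (x + w • a) p = 0) ∧
      ∀ z : ℂ, MvPolynomial.aeval (x + z • a) p =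
        MvPolynomial.aeval a p * (m.map fun w => z - w).prod := by
  have hc := hp.coeff_linePoly x a
  have hdeg : (linePoly p x a).natDegree = d :=
    (hp.natDegree_linePoly_le x a).antisymm
      (Polynomial.le_natDegree_of_ne_zero (by rwa [hc]))
  have hs := IsAlgClosed.splits (linePoly p x a)
  refine ⟨(linePoly p x a).roots, hs.natDegree_eq_card_roots.symm.trans hdeg, ?_, ?_⟩
  · intro w hw
    rw [← eval_linePoly]
    exact (Polynomial.mem_roots'.1 hw).2
  · intro z
    rw [← eval_linePoly, hs.eval_eq_prod_roots, Polynomial.leadingCoeff, hdeg, hc]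

/-- If all roots on a complex line lie in the closed lower half plane, then the polynomial is
bounded below on the upper half plane. -/
theorem IsHomogeneous.le_norm_aeval_of_roots_im_nonpos (hp : p.IsHomogeneous d) (x a : ι → ℂ)
    (ha : MvPolynomial.aeval a p ≠ 0)
    (hroots : ∀ w : ℂ, MvPolynomial.aeval (x + w • a) p = 0 → w.im ≤ 0) (z : ℂ) (hz : 0 ≤ z.im) :
    ‖MvPolynomial.aeval a p‖ * z.im ^ d ≤ ‖MvPolynomial.aeval (x + z • a) p‖ := by
  obtain ⟨m, rfl, hm, hf⟩ := hp.exists_complex_factorization x a ha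
  rw [hf, norm_mul]
  refine mul_le_mul_of_nonneg_left ?_ (norm_nonneg _)
  have key : ∀ w ∈ m, z.im ≤ ‖z - w‖ := fun w hw =>
    calc z.im ≤ (z - w).im := by
            have := hroots w (hm w hw)
            simp only [Complex.sub_im]; linarith
      _ ≤ ‖z - w‖ := (le_abs_self _).trans (Complex.abs_im_le_norm _)
  clear hf hm hp
  induction m using Multiset.induction_on with
  | empty => simp
  | cons w m ih =>
    rw [Multiset.card_cons, Multiset.map_cons, Multiset.prod_cons, norm_mul, pow_succ']
    exact mul_le_mul (key w (Multiset.mem_cons_self w m))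
      (ih fun v hv => key v (Multiset.mem_cons_of_mem hv)) (pow_nonneg hz _) (norm_nonneg _)

theorem aeval_ofReal (x : ι → ℝ) :
    MvPolynomial.aeval (fun i => (x i : ℂ)) p = ((eval x p : ℝ) : ℂ) := by
  have := MvPolynomial.aeval_algebraMap_apply ℂ x p
  simpa [Function.comp_def] using this

theorem aeval_conj (x : ι → ℂ) :
    MvPolynomial.aeval (fun i => (starRingEnd ℂ) (x i)) p =
      (starRingEnd ℂ) (MvPolynomial.aeval x p) := by
  exact (comp_aeval_apply x Complex.conjAe.toAlgHom p).symm

theorem continuous_aeval_complex :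
    Continuous fun x : ι → ℂ => MvPolynomial.aeval x p := by
  simp only [aeval_def, eval₂_eq_eval_map]
  exact continuous_eval _

end Complex

end MvPolynomial

/-! ### Hyperbolic polynomials and the topology of their cones. -/

namespace MvPolynomial

section Hyperbolic

variable {ι : Type*} {p : MvPolynomial ι ℝ} {d : ℕ} {a b x : ι → ℝ}

/-- `p` is hyperbolic in the direction `a`, with the sign normalized so that `p a` is positive. -/
def IsHyperbolic (p : MvPolynomial ι ℝ) (a : ι → ℝ) : Prop :=
  0 < eval a p ∧ ∀ (x : ι → ℝ) (z : ℂ),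
    MvPolynomial.aeval ((fun i => (x i : ℂ)) + z • fun i => (a i : ℂ)) p = 0 → z.im = 0

/-- The hyperbolicity cone of `p` in the direction `a`. -/
def hyperbolicityCone (p : MvPolynomial ι ℝ) (a : ι → ℝ) : Set (ι → ℝ) :=
  {x | ∀ s : ℝ, 0 ≤ s → eval (x + s • a) p ≠ 0}

theorem IsHomogeneous.eval_smul (hp : p.IsHomogeneous d) (c : ℝ) (x : ι → ℝ) :
    eval (c • x) p = c ^ d * eval x p := by
  simpa using hp.aeval_smul (A := ℝ) c x

theorem aeval_ofReal_add_smul (x a : ι → ℝ) (t : ℝ) :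
    MvPolynomial.aeval ((fun i => (x i : ℂ)) + (t : ℂ) • fun i => (a i : ℂ)) p =
      ((eval (x + t • a) p : ℝ) : ℂ) := by
  rw [← aeval_ofReal]
  congr 2
  ext i
  simp

/-- The sign convention is that of the future cone: the `w` are the roots of `p(x - w a)`, so `x` is
in the cone when they are all positive. Homogeneity extends the factorization from the line to the
plane of `a` and `x`. -/
theorem IsHyperbolic.exists_factorization (h : IsHyperbolic p a) (hp : p.IsHomogeneous d)
    (x : ι → ℝ) :
    ∃ m : Multiset ℝ, m.card = d ∧ (∀ w ∈ m, eval (x - w • a) p = 0) ∧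
      ∀ t s : ℝ, eval (t • a + s • x) p = eval a p * (m.map fun w => t + s * w).prod := by
  have ha : MvPolynomial.aeval (fun i => (a i : ℂ)) p ≠ 0 := by
    rw [aeval_ofReal]; exact_mod_cast h.1.ne'
  obtain ⟨m, hm, hroot, hf⟩ := hp.exists_complex_factorization (fun i => (x i : ℂ)) _ ha
  have hre : ∀ w ∈ m, ((w.re : ℝ) : ℂ) = w := fun w hw =>
    Complex.ext rfl (h.2 x w (hroot w hw)).symm
  have hline : ∀ t : ℝ, eval (x + t • a) p = eval a p * (m.map fun w => t - w.re).prod := by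
    intro t
    have := hf t
    rw [aeval_ofReal_add_smul, aeval_ofReal] at this
    apply Complex.ofReal_injective
    rw [this, Complex.ofReal_mul, ← Complex.ofRealHom_eq_coe (Multiset.prod _),
      map_multiset_prod, Multiset.map_map]
    congr 2
    refine Multiset.map_congr rfl fun w hw => ?_
    simp [hre w hw]
  refine ⟨m.map fun w => -w.re, by simpa using hm, ?_, ?_⟩
  · intro w hw
    obtain ⟨v, hv, rfl⟩ := Multiset.mem_map.1 hw
    rw [neg_smul, sub_neg_eq_add, hline, Multiset.prod_eq_zero, mul_zero]
    exact Multiset.mem_map.2 ⟨v, hv, sub_self _⟩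
  · intro t s
    rw [Multiset.map_map]
    rcases eq_or_ne s 0 with rfl | hs
    · simp [hp.eval_smul, hm, mul_comm]
    · have : t • a + s • x = s • (x + (t / s) • a) := by
        rw [smul_add, smul_smul, mul_div_cancel₀ _ hs, add_comm]
      have hmap : m.map ((fun w => t + s * w) ∘ fun w : ℂ => -w.re) =
          m.map fun w => s * (t / s - w.re) := by
        refine Multiset.map_congr rfl fun w _ => ?_
        simp only [Function.comp_apply]
        field_simp
        ring
      rw [this, hp.eval_smul, hline, hmap, Multiset.prod_map_mul, Multiset.map_const',
        Multiset.prod_replicate, hm, mul_left_comm]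

/-- All roots are positive, so each factor `s + w` is at least `s`. Unlike nonvanishing, this bound
passes to the closure of the cone. -/
theorem IsHyperbolic.le_eval_of_mem (h : IsHyperbolic p a) (hp : p.IsHomogeneous d)
    (hx : x ∈ hyperbolicityCone p a) {s : ℝ} (hs : 0 ≤ s) :
    eval a p * s ^ d ≤ eval (x + s • a) p := by
  obtain ⟨m, rfl, hroot, hf⟩ := h.exists_factorization hp x
  have h1 := hf s 1
  rw [one_smul, add_comm] at h1
  rw [h1]
  refine mul_le_mul_of_nonneg_left ?_ h.1.le
  have key : ∀ w ∈ m, s ≤ s + 1 * w := by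
    intro w hw
    by_contra hlt
    have := hroot w hw
    rw [sub_eq_add_neg, ← neg_smul] at this
    exact hx (-w) (by linarith) this
  clear hf hroot hp h1
  induction m using Multiset.induction_on with
  | empty => simp
  | cons w m ih =>
    rw [Multiset.card_cons, Multiset.map_cons, Multiset.prod_cons, pow_succ']
    exact mul_le_mul (key w (Multiset.mem_cons_self w m))
      (ih fun v hv => key v (Multiset.mem_cons_of_mem hv)) (pow_nonneg hs _)
      (hs.trans (key w (Multiset.mem_cons_self w m)))

theorem root_pos_of_mem_hyperbolicityCone (hx : x ∈ hyperbolicityCone p a) {w : ℝ}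
    (hw : eval (x - w • a) p = 0) : 0 < w := by
  by_contra hlt
  rw [sub_eq_add_neg, ← neg_smul] at hw
  exact hx (-w) (by linarith) hw

theorem eval_ne_zero_of_mem_hyperbolicityCone (hx : x ∈ hyperbolicityCone p a) :
    eval x p ≠ 0 := by
  simpa using hx 0 le_rfl

theorem IsHyperbolic.self_mem (h : IsHyperbolic p a) (hp : p.IsHomogeneous d) :
    a ∈ hyperbolicityCone p a := by
  intro s hs
  have : a + s • a = (1 + s) • a := by rw [add_smul, one_smul]
  rw [this, hp.eval_smul]
  have := h.1
  positivity

theorem smul_mem_hyperbolicityCone (hp : p.IsHomogeneous d) (hx : x ∈ hyperbolicityCone p a)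
    {c : ℝ} (hc : 0 < c) : c • x ∈ hyperbolicityCone p a := by
  intro s hs
  have : c • x + s • a = c • (x + (s / c) • a) := by
    rw [smul_add, smul_smul, mul_div_cancel₀ _ hc.ne']
  rw [this, hp.eval_smul]
  exact mul_ne_zero (pow_pos hc _).ne' (hx _ (by positivity))

/-- Up to positive scaling, the ray from `x` in the direction `a` is the segment from `x` to `a`
without its endpoint `a`. The compact parameter interval yields openness, and the segment yields
star-shapedness. -/
theorem mem_hyperbolicityCone_iff_segment (hp : p.IsHomogeneous d) (ha : eval a p ≠ 0) :
    x ∈ hyperbolicityCone p a ↔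
      ∀ t ∈ Set.Icc (0 : ℝ) 1, eval ((1 - t) • x + t • a) p ≠ 0 := by
  constructor
  · rintro hx t ⟨h0, h1⟩
    rcases h1.eq_or_lt with rfl | h1
    · simpa using ha
    · have ht : 0 < 1 - t := by linarith
      have : (1 - t) • x + t • a = (1 - t) • (x + (t / (1 - t)) • a) := by
        rw [smul_add, smul_smul, mul_div_cancel₀ _ ht.ne']
      rw [this, hp.eval_smul]
      exact mul_ne_zero (pow_pos ht _).ne' (hx _ (by positivity))
  · intro hx s hs
    have h1 : (0 : ℝ) < 1 + s := by linarith
    have : x + s • a = (1 + s) • ((1 - s / (1 + s)) • x + (s / (1 + s)) • a) := by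
      rw [smul_add, smul_smul, smul_smul, mul_div_cancel₀ _ h1.ne', mul_sub,
        mul_div_cancel₀ _ h1.ne', mul_one, add_sub_cancel_right, one_smul]
    rw [this, hp.eval_smul]
    refine mul_ne_zero (pow_pos h1 _).ne' (hx _ ⟨by positivity, ?_⟩)
    rw [div_le_one h1]; linarith

theorem isOpen_hyperbolicityCone (hp : p.IsHomogeneous d) (ha : eval a p ≠ 0) :
    IsOpen (hyperbolicityCone p a) := by
  rw [isOpen_iff_eventually]
  intro x hx
  simp only [mem_hyperbolicityCone_iff_segment hp ha] at hx ⊢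
  refine isCompact_Icc.eventually_forall_of_forall_eventually fun t ht => ?_
  have hc : Continuous fun y : (ι → ℝ) × ℝ => eval ((1 - y.2) • y.1 + y.2 • a) p :=
    (continuous_eval p).comp (by fun_prop)
  exact hc.continuousAt.eventually_ne (hx t ht)

theorem IsHyperbolic.le_eval_of_mem_closure (h : IsHyperbolic p a) (hp : p.IsHomogeneous d)
    (hx : x ∈ closure (hyperbolicityCone p a)) {s : ℝ} (hs : 0 ≤ s) :
    eval a p * s ^ d ≤ eval (x + s • a) p := by
  have hcl : IsClosed {y : ι → ℝ | eval a p * s ^ d ≤ eval (y + s • a) p} :=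
    isClosed_le continuous_const ((continuous_eval p).comp (by fun_prop))
  exact closure_minimal (fun y hy => h.le_eval_of_mem hp hy hs) hcl hx

/-- The closed lower bound handles `s > 0`; only `s = 0` needs the assumption on `x`. In other
words, `p` vanishes on the boundary of the cone. -/
theorem IsHyperbolic.mem_of_mem_closure (h : IsHyperbolic p a) (hp : p.IsHomogeneous d)
    (hx : x ∈ closure (hyperbolicityCone p a)) (hx0 : eval x p ≠ 0) :
    x ∈ hyperbolicityCone p a := by
  intro s hs
  rcases hs.eq_or_lt with rfl | hs'
  · simpa using hx0
  · exact ((mul_pos h.1 (pow_pos hs' d)).trans_le (h.le_eval_of_mem_closure hp hx hs)).ne'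

/-- The hyperbolicity cone is a union of connected components of the nonvanishing locus. -/
theorem IsHyperbolic.subset_of_isPreconnected (h : IsHyperbolic p a) (hp : p.IsHomogeneous d)
    {T : Set (ι → ℝ)} (hT : IsPreconnected T) (hT0 : ∀ y ∈ T, eval y p ≠ 0)
    (hne : (T ∩ hyperbolicityCone p a).Nonempty) : T ⊆ hyperbolicityCone p a :=
  hT.subset_of_closure_inter_subset (isOpen_hyperbolicityCone hp h.1.ne') hne
    fun y hy => h.mem_of_mem_closure hp hy.1 (hT0 y hy.2)

theorem IsHyperbolic.eval_pos_of_mem (h : IsHyperbolic p a) (hp : p.IsHomogeneous d)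
    (hx : x ∈ hyperbolicityCone p a) : 0 < eval x p := by
  refine lt_of_le_of_ne ?_ (eval_ne_zero_of_mem_hyperbolicityCone hx).symm
  have h1 := h.le_eval_of_mem hp hx (le_refl (0 : ℝ))
  rw [zero_smul, add_zero] at h1
  exact (mul_nonneg h.1.le (pow_nonneg le_rfl d)).trans h1

end Hyperbolic

end MvPolynomial

/-! ### Change of the hyperbolic direction, and convexity of the cone. -/

namespace MvPolynomial

section Direction

variable {ι : Type*} {p : MvPolynomial ι ℝ} {d : ℕ} {a b x : ι → ℝ}

/-- A hyperbolic polynomial does not vanish on the tube over the real line through `a`. -/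
theorem IsHyperbolic.aeval_add_ne_zero (h : IsHyperbolic p a) (x : ι → ℝ) {z : ℂ}
    (hz : z.im ≠ 0) :
    MvPolynomial.aeval ((fun i => (x i : ℂ)) + z • fun i => (a i : ℂ)) p ≠ 0 :=
  fun h0 => hz (h.2 x z h0)

/-- Roots cannot escape to infinity because `p(A) ≠ 0`. Homogenizing by a parameter `s ≥ 0` replaces
the closed half plane by a compact set of pairs `(s, z)`, and the points at infinity `s = 0`
contribute `z ^ d * p(A)`. -/
theorem isOpen_setOf_upper_nonvanishing (hp : p.IsHomogeneous d) (A X Y : ι → ℂ)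
    (hA : MvPolynomial.aeval A p ≠ 0) :
    IsOpen {r : ℝ | ∀ z : ℂ, 0 ≤ z.im →
      MvPolynomial.aeval (((r : ℂ) • X + Y) + z • A) p ≠ 0} := by
  set K : Set (ℝ × ℂ) := Metric.sphere 0 1 ∩ ({q | 0 ≤ q.1} ∩ {q | 0 ≤ q.2.im}) with hK
  have hKc : IsCompact K := by
    refine (isCompact_sphere _ _).inter_right (IsClosed.inter ?_ ?_)
    · exact isClosed_le continuous_const continuous_fst
    · exact isClosed_le continuous_const (Complex.continuous_im.comp continuous_snd)
  have hset : ∀ r : ℝ, (∀ z : ℂ, 0 ≤ z.im →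
      MvPolynomial.aeval (((r : ℂ) • X + Y) + z • A) p ≠ 0) ↔
      ∀ q ∈ K, MvPolynomial.aeval ((q.1 : ℂ) • ((r : ℂ) • X + Y) + q.2 • A) p ≠ 0 := by
    intro r
    constructor
    · rintro hr ⟨s, z⟩ ⟨hn, hs, hz⟩
      simp only [Set.mem_ofPred_eq] at hs hz ⊢
      rcases hs.eq_or_lt with rfl | hs'
      · have hz0 : z ≠ 0 := by
          rintro rfl
          simp at hn
        simp only [Complex.ofReal_zero, zero_smul, zero_add]
        rw [hp.aeval_smul]
        exact mul_ne_zero (pow_ne_zero _ hz0) hA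
      · have hsC : (s : ℂ) ≠ 0 := by exact_mod_cast hs'.ne'
        have : (s : ℂ) • ((r : ℂ) • X + Y) + z • A =
            (s : ℂ) • (((r : ℂ) • X + Y) + (z / s) • A) := by
          rw [smul_add (s : ℂ) _ ((z / s) • A), smul_smul, mul_div_cancel₀ _ hsC]
        rw [this, hp.aeval_smul]
        refine mul_ne_zero (pow_ne_zero _ hsC) (hr _ ?_)
        rw [Complex.div_ofReal_im]
        positivity
    · intro hr z hz
      set n : ℝ := ‖((1 : ℝ), z)‖ with hn
      have hn0 : 0 < n := norm_pos_iff.2 (by simp)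
      have hnC : (n : ℂ) ≠ 0 := by exact_mod_cast hn0.ne'
      have hmem : (n⁻¹ • ((1 : ℝ), z)) ∈ K := by
        refine ⟨?_, ?_, ?_⟩
        · rw [mem_sphere_zero_iff_norm, norm_smul, norm_inv, Real.norm_of_nonneg hn0.le,
            inv_mul_cancel₀ hn0.ne']
        · simp [hn0.le]
        · simp only [Set.mem_ofPred_eq, Prod.smul_snd, Complex.real_smul]
          rw [Complex.im_ofReal_mul]
          positivity
      have := hr _ hmem
      intro h0
      apply this
      have heq : (((n⁻¹ • ((1 : ℝ), z)).1 : ℝ) : ℂ) • ((r : ℂ) • X + Y) +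
          (n⁻¹ • ((1 : ℝ), z)).2 • A = ((n⁻¹ : ℝ) : ℂ) • (((r : ℂ) • X + Y) + z • A) := by
        rw [smul_add _ _ (z • A), smul_smul]
        simp
      rw [heq, hp.aeval_smul, h0, mul_zero]
  simp only [hset]
  rw [isOpen_iff_eventually]
  intro r hr
  refine hKc.eventually_forall_of_forall_eventually fun q hq => ?_
  have hc : Continuous fun y : ℝ × (ℝ × ℂ) =>
      MvPolynomial.aeval ((y.2.1 : ℂ) • ((y.1 : ℂ) • X + Y) + y.2.2 • A) p :=
    continuous_aeval_complex.comp (by fun_prop)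
  exact hc.continuousAt.eventually_ne (hr q hq)

/-- Continuity in `r`, with `x` replaced by `r x`: the roots `z` never cross the real axis, since
for real `z` the imaginary part of the argument is `c a`, where hyperbolicity applies. At `r = 0`
the roots lie in the lower half plane because `b` is in the cone. -/
theorem IsHyperbolic.im_neg_of_aeval_eq_zero (h : IsHyperbolic p a) (hp : p.IsHomogeneous d)
    (hb : b ∈ hyperbolicityCone p a) (x : ι → ℝ) {c : ℝ} (hc : 0 < c) (z : ℂ)
    (hz : MvPolynomial.aeval (((fun i => (x i : ℂ)) + (c * Complex.I) • fun i => (a i : ℂ)) +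
      z • fun i => (b i : ℂ)) p = 0) : z.im < 0 := by
  set X : ι → ℂ := fun i => (x i : ℂ) with hX
  set B : ι → ℂ := fun i => (b i : ℂ) with hB
  set T : ι → ℂ := fun i => (a i : ℂ) with hT
  have hB0 : MvPolynomial.aeval B p ≠ 0 := by
    rw [hB, aeval_ofReal]
    exact_mod_cast eval_ne_zero_of_mem_hyperbolicityCone hb
  have hcI : ((c : ℂ) * Complex.I) ≠ 0 := mul_ne_zero (by exact_mod_cast hc.ne') Complex.I_ne_zero
  have hreal : ∀ (r : ℝ) (z : ℂ), z.im = 0 →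
      MvPolynomial.aeval (((r : ℂ) • X + (c * Complex.I) • T) + z • B) p ≠ 0 := by
    intro r z hz
    have hzr : z = (z.re : ℂ) := Complex.ext rfl hz
    have := h.aeval_add_ne_zero (r • x + z.re • b) (z := c * Complex.I) (by simpa using hc.ne')
    convert this using 2
    rw [hzr, add_right_comm]
    congr 1
    ext i
    simp [hX, hB, hT]
  set U : Set ℝ := {r : ℝ | ∀ z : ℂ, 0 ≤ z.im →
      MvPolynomial.aeval (((r : ℂ) • X + (c * Complex.I) • T) + z • B) p ≠ 0} with hU
  have hopen : IsOpen U := isOpen_setOf_upper_nonvanishing hp B X _ hB0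
  have hclosed : IsClosed U := by
    refine isClosed_of_closure_subset fun r hr z hz => ?_
    rcases hz.eq_or_lt with hz0 | hz0
    · exact hreal r z hz0.symm
    · have hcl : IsClosed {r : ℝ | ‖MvPolynomial.aeval B p‖ * z.im ^ d ≤
          ‖MvPolynomial.aeval (((r : ℂ) • X + (c * Complex.I) • T) + z • B) p‖} :=
        isClosed_le continuous_const (continuous_aeval_complex.comp (by fun_prop)).norm
      -- The lower bound does not depend on `r`, so it survives the limit and excludes a zero there.
      have hle := closure_minimal (fun s (hs : s ∈ U) =>
        hp.le_norm_aeval_of_roots_im_nonpos _ B hB0 (fun w hw => by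
          by_contra hlt
          exact hs w (not_le.1 hlt).le hw) z hz) hcl hr
      refine norm_pos_iff.1 (lt_of_lt_of_le ?_ hle)
      exact mul_pos (norm_pos_iff.2 hB0) (pow_pos hz0 d)
  have hzero : (0 : ℝ) ∈ U := by
    intro z hz h0
    rw [Complex.ofReal_zero, zero_smul, zero_add] at h0
    have hz0 : z ≠ 0 := by
      rintro rfl
      rw [zero_smul, add_zero, hp.aeval_smul, hT, aeval_ofReal] at h0
      exact mul_ne_zero (pow_ne_zero _ hcI) (by exact_mod_cast h.1.ne') h0
    have h1 : MvPolynomial.aeval (B + (c * Complex.I / z) • T) p = 0 := by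
      have : (c * Complex.I) • T + z • B = z • (B + (c * Complex.I / z) • T) := by
        rw [smul_add, smul_smul, mul_div_cancel₀ _ hz0, add_comm]
      rw [this, hp.aeval_smul] at h0
      exact (mul_eq_zero.1 h0).resolve_left (pow_ne_zero _ hz0)
    have him := h.2 b _ h1
    set w : ℂ := c * Complex.I / z with hw
    have hwr : w = (w.re : ℂ) := Complex.ext rfl him
    rw [hwr, aeval_ofReal_add_smul] at h1
    -- Here `w` is real and negative, so `w z = c i` with `c > 0` forces `Im z < 0`.
    have hneg : w.re < 0 := by
      by_contra hlt
      exact hb _ (not_lt.1 hlt) (by exact_mod_cast h1)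
    have hzw : w * z = c * Complex.I := div_mul_cancel₀ _ hz0
    have : w.re * z.im = c := by
      have := congrArg Complex.im hzw
      rw [hwr, Complex.im_ofReal_mul] at this
      simpa using this
    nlinarith
  have huniv := IsClopen.eq_univ ⟨hclosed, hopen⟩ ⟨0, hzero⟩
  by_contra hlt
  have h1 : (1 : ℝ) ∈ U := huniv ▸ Set.mem_univ _
  refine h1 z (not_lt.1 hlt) ?_
  rwa [Complex.ofReal_one, one_smul]

/-- A hyperbolic polynomial is hyperbolic in every direction of its hyperbolicity cone. -/
theorem IsHyperbolic.of_mem (h : IsHyperbolic p a) (hp : p.IsHomogeneous d)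
    (hb : b ∈ hyperbolicityCone p a) : IsHyperbolic p b := by
  have hB0 : MvPolynomial.aeval (fun i => (b i : ℂ)) p ≠ 0 := by
    rw [aeval_ofReal]
    exact_mod_cast eval_ne_zero_of_mem_hyperbolicityCone hb
  have key : ∀ (x : ι → ℝ) (z : ℂ), 0 < z.im →
      MvPolynomial.aeval ((fun i => (x i : ℂ)) + z • fun i => (b i : ℂ)) p ≠ 0 := by
    intro x z hz
    set F : ℝ → ℂ := fun c => MvPolynomial.aeval
      (((fun i => (x i : ℂ)) + (c * Complex.I) • fun i => (a i : ℂ)) + z • fun i => (b i : ℂ)) p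
    have hF : Continuous F := continuous_aeval_complex.comp (by fun_prop)
    -- The bound is uniform in the shift `c`, which can therefore be sent to zero.
    have hle : ‖MvPolynomial.aeval (fun i => (b i : ℂ)) p‖ * z.im ^ d ≤ ‖F 0‖ := by
      refine ge_of_tendsto (x := nhdsWithin (0 : ℝ) (Set.Ioi 0))
        (hF.norm.continuousAt.tendsto.mono_left nhdsWithin_le_nhds) ?_
      filter_upwards [self_mem_nhdsWithin] with c hc
      exact hp.le_norm_aeval_of_roots_im_nonpos _ _ hB0
        (fun w hw => (h.im_neg_of_aeval_eq_zero hp hb x hc w hw).le) z hz.le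
    have h0 : F 0 ≠ 0 :=
      norm_pos_iff.1 ((mul_pos (norm_pos_iff.2 hB0) (pow_pos hz d)).trans_le hle)
    simpa [F] using h0
  refine ⟨h.eval_pos_of_mem hp hb, fun x z hz => ?_⟩
  rcases lt_trichotomy z.im 0 with hlt | heq | hgt
  · refine absurd ?_ (key x ((starRingEnd ℂ) z) (by simpa using hlt))
    have := aeval_conj (p := p) ((fun i => (x i : ℂ)) + z • fun i => (b i : ℂ))
    rw [hz, map_zero] at this
    rw [← this]
    congr 2
    ext i
    simp
  · exact heq
  · exact absurd hz (key x z hgt)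

theorem IsHyperbolic.segment_nonvanishing (h : IsHyperbolic p a) (hp : p.IsHomogeneous d)
    (hx : x ∈ hyperbolicityCone p a) : ∀ y ∈ segment ℝ x a, eval y p ≠ 0 := by
  intro y hy
  rw [segment_eq_image] at hy
  obtain ⟨t, ht, rfl⟩ := hy
  exact (mem_hyperbolicityCone_iff_segment hp h.1.ne').1 hx t ht

theorem IsHyperbolic.mem_of_segment (h : IsHyperbolic p a) (hp : p.IsHomogeneous d)
    (hb : b ∈ hyperbolicityCone p a) (hx : ∀ y ∈ segment ℝ x b, eval y p ≠ 0) :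
    x ∈ hyperbolicityCone p a :=
  h.subset_of_isPreconnected hp (convex_segment x b).isPreconnected hx
    ⟨b, right_mem_segment ℝ x b, hb⟩ (left_mem_segment ℝ x b)

theorem IsHyperbolic.hyperbolicityCone_eq (h : IsHyperbolic p a) (hp : p.IsHomogeneous d)
    (hb : b ∈ hyperbolicityCone p a) : hyperbolicityCone p b = hyperbolicityCone p a := by
  have hB := h.of_mem hp hb
  have hab : a ∈ hyperbolicityCone p b := by
    refine hB.mem_of_segment hp (hB.self_mem hp) ?_
    rw [segment_symm]
    exact h.segment_nonvanishing hp hb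
  refine Set.Subset.antisymm (fun x hx => ?_) fun x hx => ?_
  · exact h.mem_of_segment hp hb (hB.segment_nonvanishing hp hx)
  · exact hB.mem_of_segment hp hab (h.segment_nonvanishing hp hx)

/-- Recentring the cone at `y` makes it star-shaped about `y`, so the segment from `x` to `y` avoids
the zeros of `p`. -/
theorem IsHyperbolic.convex_hyperbolicityCone (h : IsHyperbolic p a) (hp : p.IsHomogeneous d) :
    Convex ℝ (hyperbolicityCone p a) := by
  rw [convex_iff_segment_subset]
  intro x hx y hy
  refine h.subset_of_isPreconnected hp (convex_segment x y).isPreconnected ?_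
    ⟨y, right_mem_segment ℝ x y, hy⟩
  rw [← h.hyperbolicityCone_eq hp hy] at hx
  exact (h.of_mem hp hy).segment_nonvanishing hp hx

end Direction

end MvPolynomial

/-! ### Gradients, roots and dual cones. -/

namespace MvPolynomial

section Gradient

variable {ι : Type*} [Fintype ι] {p : MvPolynomial ι ℝ} {d : ℕ} {a b v x : ι → ℝ}

/-- The gradient of a real polynomial. -/
noncomputable def gradient (p : MvPolynomial ι ℝ) (x : ι → ℝ) : ι → ℝ := fun i => eval x (pderiv i p)

/-- The dual cone, in coordinates, of a set of vectors. -/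
def dualCone (S : Set (ι → ℝ)) : Set (ι → ℝ) := {v | ∀ k ∈ S, 0 ≤ v ⬝ᵥ k}

theorem hasDerivAt_eval_add_smul (p : MvPolynomial ι ℝ) (x h : ι → ℝ) :
    HasDerivAt (fun s : ℝ => eval (x + s • h) p) (gradient p x ⬝ᵥ h) 0 := by
  induction p using MvPolynomial.induction_on with
  | C c => simpa [gradient, dotProduct] using hasDerivAt_const (0 : ℝ) c
  | add p q hp hq =>
    have := hp.add hq
    simp only [gradient, dotProduct, map_add, add_mul, Finset.sum_add_distrib] at this ⊢
    exact this
  | mul_X p j hp =>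
    classical
    have hX : HasDerivAt (fun s : ℝ => x j + s * h j) (h j) 0 := by
      simpa using ((hasDerivAt_id (0 : ℝ)).mul_const (h j)).const_add (x j)
    have := hp.mul hX
    simp only [zero_smul, add_zero, zero_mul] at this
    convert! this using 1
    · ext s; simp
    · simp only [gradient, dotProduct, pderiv_mul, map_add, map_mul, eval_X, pderiv_X, add_mul,
        Finset.sum_add_distrib, Finset.sum_mul]
      congr 1
      · exact Finset.sum_congr rfl fun i _ => by ring
      · rw [Finset.sum_eq_single j] <;> simp +contextual [eq_comm]

theorem IsHomogeneous.gradient_dotProduct_self (hp : p.IsHomogeneous d) (x : ι → ℝ) :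
    gradient p x ⬝ᵥ x = d * eval x p := by
  have := congrArg (eval x) hp.sum_X_mul_pderiv
  simp only [map_sum, map_mul, eval_X, nsmul_eq_mul] at this
  simpa [gradient, dotProduct, mul_comm] using this

omit [Fintype ι] in
theorem IsHomogeneous.gradient_smul (hp : p.IsHomogeneous d) (c : ℝ) (x : ι → ℝ) :
    gradient p (c • x) = c ^ (d - 1) • gradient p x := by
  ext i
  exact (hp.pderiv (i := i)).eval_smul c x

theorem hasDerivAt_multiset_prod_one_add_mul (m : Multiset ℝ) :
    HasDerivAt (fun s : ℝ => (m.map fun w => 1 + s * w).prod) m.sum 0 := by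
  induction m using Multiset.induction_on with
  | empty => simpa using hasDerivAt_const (0 : ℝ) (1 : ℝ)
  | cons w m ih =>
    have hw : HasDerivAt (fun s : ℝ => 1 + s * w) w 0 := by
      simpa using ((hasDerivAt_id (0 : ℝ)).mul_const w).const_add 1
    have := hw.mul ih
    simp only [zero_mul, add_zero, Multiset.map_const', Multiset.prod_replicate, one_pow, mul_one,
      one_mul] at this
    simp only [Multiset.map_cons, Multiset.prod_cons, Multiset.sum_cons]
    exact this

/-- The roots on the line through `x` in a hyperbolic direction `a`, with the directional
derivative of `p` at `a` along `x` expressed through their sum. -/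
theorem IsHyperbolic.exists_roots (h : IsHyperbolic p a) (hp : p.IsHomogeneous d) (x : ι → ℝ) :
    ∃ m : Multiset ℝ, m.card = d ∧ (∀ w ∈ m, eval (x - w • a) p = 0) ∧
      (∀ t s : ℝ, eval (t • a + s • x) p = eval a p * (m.map fun w => t + s * w).prod) ∧
      gradient p a ⬝ᵥ x = eval a p * m.sum := by
  obtain ⟨m, hm, hroot, hf⟩ := h.exists_factorization hp x
  refine ⟨m, hm, hroot, hf, ?_⟩
  refine (hasDerivAt_eval_add_smul p a x).unique ?_
  have := (hasDerivAt_multiset_prod_one_add_mul m).const_mul (eval a p)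
  simpa only [← hf, one_smul] using this

omit [Fintype ι] in
theorem IsHyperbolic.root_nonneg_of_mem_closure (h : IsHyperbolic p a) (hp : p.IsHomogeneous d)
    (hx : x ∈ closure (hyperbolicityCone p a)) {w : ℝ} (hw : eval (x - w • a) p = 0) : 0 ≤ w := by
  by_contra hlt
  have hw0 : 0 < -w := by linarith
  have := h.le_eval_of_mem_closure hp hx hw0.le
  rw [neg_smul, ← sub_eq_add_neg, hw] at this
  exact absurd this (not_le.2 (mul_pos h.1 (pow_pos hw0 d)))

omit [Fintype ι] in
/-- If the restriction of `p` to the plane of `a` and `c` only depends on the coefficient of `a`,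
then the hyperbolicity cone contains a line in the direction `c`. -/
theorem IsHyperbolic.add_smul_mem (h : IsHyperbolic p a) (hp : p.IsHomogeneous d)
    (hb : b ∈ hyperbolicityCone p a) {c : ι → ℝ}
    (hc : ∀ t s : ℝ, eval (t • b + s • c) p = eval b p * t ^ d) (s : ℝ) :
    b + s • c ∈ hyperbolicityCone p a := by
  rw [← h.hyperbolicityCone_eq hp hb]
  intro t ht
  have : b + s • c + t • b = (1 + t) • b + s • c := by rw [add_smul, one_smul]; abel
  rw [this, hc]
  exact mul_ne_zero (eval_ne_zero_of_mem_hyperbolicityCone hb) (by positivity)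

/-- Moving `v` by a small amount along each `±eᵢ` stays in the dual cone. With its converse
`mem_interior_dualCone`, this turns interiority into an inequality that passes to the closure. -/
theorem exists_pos_forall_mul_abs_le {S : Set (ι → ℝ)} (hv : v ∈ interior (dualCone S)) :
    ∃ ε > 0, ∀ k ∈ closure S, ∀ i, ε * |k i| ≤ v ⬝ᵥ k := by
  classical
  obtain ⟨ε, hε, hball⟩ := Metric.mem_nhds_iff.1 (mem_interior_iff_mem_nhds.1 hv)
  refine ⟨ε / 2, by positivity, fun k hk i => ?_⟩
  have hcl : IsClosed {k : ι → ℝ | ε / 2 * |k i| ≤ v ⬝ᵥ k} :=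
    isClosed_le (by fun_prop) (by unfold dotProduct; fun_prop)
  refine closure_minimal (fun k hk => ?_) hcl hk
  have key : ∀ c : ℝ, |c| ≤ ε / 2 → 0 ≤ v ⬝ᵥ k + c * k i := by
    intro c hc
    have hmem : v + Pi.single i c ∈ dualCone S := by
      apply hball
      rw [Metric.mem_ball, dist_eq_norm, add_sub_cancel_left, Pi.norm_single, Real.norm_eq_abs]
      linarith
    have := hmem k hk
    rwa [add_dotProduct, single_dotProduct] at this
  have h1 := key (ε / 2) (by rw [abs_of_pos (by positivity)])
  have h2 := key (-(ε / 2)) (by rw [abs_neg, abs_of_pos (by positivity)])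
  simp only [Set.mem_ofPred_eq]
  rcases abs_cases (k i) with ⟨h, -⟩ | ⟨h, -⟩ <;> rw [h] <;> linarith

theorem mem_interior_dualCone {S : Set (ι → ℝ)} {ε : ℝ} (hε : 0 < ε)
    (h : ∀ k ∈ S, ∀ i, ε * |k i| ≤ v ⬝ᵥ k) : v ∈ interior (dualCone S) := by
  rw [mem_interior_iff_mem_nhds, Metric.mem_nhds_iff]
  -- Each coordinate may cost at most the share `(v ⬝ᵥ k) / n`; the extra `1` keeps `n` positive
  -- when `ι` is empty.
  set n : ℝ := Fintype.card ι + 1 with hn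
  have hn0 : 0 < n := by positivity
  refine ⟨ε / n, by positivity, fun u hu k hk => ?_⟩
  have h0 : 0 ≤ v ⬝ᵥ k := by
    rcases isEmpty_or_nonempty ι with hι | ⟨⟨i⟩⟩
    · simp
    · exact (by positivity : 0 ≤ ε * |k i|).trans (h k hk i)
  have hi : ∀ i, |(u - v) i * k i| ≤ (v ⬝ᵥ k) / n := by
    intro i
    rw [abs_mul]
    have h1 : |(u - v) i| ≤ ε / n := by
      rw [Metric.mem_ball, dist_eq_norm] at hu
      exact (norm_le_pi_norm (u - v) i).trans hu.le
    calc |(u - v) i| * |k i| ≤ ε / n * |k i| := mul_le_mul_of_nonneg_right h1 (abs_nonneg _)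
      _ = (ε * |k i|) / n := by ring
      _ ≤ (v ⬝ᵥ k) / n := div_le_div_of_nonneg_right (h k hk i) hn0.le
  have hsum : |(u - v) ⬝ᵥ k| ≤ v ⬝ᵥ k := by
    calc |(u - v) ⬝ᵥ k| ≤ ∑ i, |(u - v) i * k i| := Finset.abs_sum_le_sum_abs _ _
      _ ≤ ∑ _i : ι, (v ⬝ᵥ k) / n := Finset.sum_le_sum fun i _ => hi i
      _ = (Fintype.card ι / n) * (v ⬝ᵥ k) := by
        rw [Finset.sum_const, nsmul_eq_mul, Finset.card_univ]; ring
      _ ≤ 1 * (v ⬝ᵥ k) := by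
        refine mul_le_mul_of_nonneg_right ?_ h0
        rw [div_le_one hn0, hn]; linarith
      _ = v ⬝ᵥ k := one_mul _
  rw [sub_dotProduct] at hsum
  have := (abs_le.1 hsum).1
  linarith

end Gradient

end MvPolynomial

/-! ### Arithmetic and geometric means of a multiset, through the logarithm. -/

theorem Multiset.log_prod_le {m : Multiset ℝ} (hm : ∀ w ∈ m, 0 < w) {c : ℝ} (hc : 0 < c) :
    Real.log m.prod ≤ m.card * Real.log c + m.sum / c - m.card := by
  induction m using Multiset.induction_on with
  | empty => simp
  | cons w m ih =>
    have hw := hm w (Multiset.mem_cons_self w m)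
    have hm' : ∀ v ∈ m, 0 < v := fun v hv => hm v (Multiset.mem_cons_of_mem hv)
    have h1 := Real.log_le_sub_one_of_pos (div_pos hw hc)
    rw [Real.log_div hw.ne' hc.ne'] at h1
    have h2 := ih hm'
    rw [Multiset.prod_cons, Multiset.sum_cons, Multiset.card_cons,
      Real.log_mul hw.ne' (Multiset.prod_pos hm').ne', add_div]
    push_cast
    linarith

/-- Taking `c` to be the product `π` in `Multiset.log_prod_le` leaves `log π ≤ n log π`, which for
`n ≥ 2` means `log π ≥ 0`. -/
theorem Multiset.one_le_prod_of_sum_eq {m : Multiset ℝ} (hm : ∀ w ∈ m, 0 < w) (h2 : 2 ≤ m.card)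
    (hsum : m.sum = m.card * m.prod) : 1 ≤ m.prod := by
  have hp := Multiset.prod_pos hm
  have h := Multiset.log_prod_le hm hp
  rw [hsum, mul_div_cancel_right₀ _ hp.ne', add_sub_cancel_right] at h
  have h2' : (2 : ℝ) ≤ m.card := by exact_mod_cast h2
  have : 0 ≤ Real.log m.prod := by nlinarith
  exact (Real.log_nonneg_iff hp).1 this

/-- This is the equality case: `log w < w - 1` is strict for a single `w ≠ 1`, and the remaining
factors cannot compensate. -/
theorem Multiset.eq_one_of_prod_eq_one_of_sum_eq {m : Multiset ℝ} (hm : ∀ w ∈ m, 0 < w)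
    (hprod : m.prod = 1) (hsum : m.sum = m.card) : ∀ w ∈ m, w = 1 := by
  intro w hw
  obtain ⟨n, rfl⟩ := Multiset.exists_cons_of_mem hw
  have hw0 := hm w hw
  have hn : ∀ v ∈ n, 0 < v := fun v hv => hm v (Multiset.mem_cons_of_mem hv)
  have h1 := Multiset.log_prod_le hn one_pos
  have h2 : Real.log w + Real.log n.prod = 0 := by
    rw [← Real.log_mul hw0.ne' (Multiset.prod_pos hn).ne', ← Multiset.prod_cons, hprod,
      Real.log_one]
  rw [Multiset.sum_cons, Multiset.card_cons] at hsum
  push_cast at hsum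
  rw [Real.log_one, div_one] at h1
  by_contra hne
  have := Real.log_lt_sub_one_of_pos hw0 hne
  linarith

/-! ### The gradient as a bijection from the cone to the interior of its dual. -/

namespace MvPolynomial

section Bijection

variable {ι : Type*} [Fintype ι] {p : MvPolynomial ι ℝ} {d : ℕ} {a b v x : ι → ℝ}

/-- The pairing with `v` is nonnegative along the whole line, hence constant; as it dominates every
coordinate, the line is bounded. -/
theorem eq_zero_of_forall_add_smul_mem {S : Set (ι → ℝ)} (hv : v ∈ interior (dualCone S))
    {c : ι → ℝ} (hc : ∀ s : ℝ, b + s • c ∈ S) : c = 0 := by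
  obtain ⟨ε, hε, hle⟩ := exists_pos_forall_mul_abs_le hv
  have hS : ∀ s : ℝ, 0 ≤ v ⬝ᵥ b + s * (v ⬝ᵥ c) := fun s => by
    have := interior_subset hv _ (hc s)
    rwa [dotProduct_add, dotProduct_smul, smul_eq_mul] at this
  have hvc : v ⬝ᵥ c = 0 := by
    by_contra hne
    -- At this parameter the pairing with `v` would be `-1`.
    have := hS (-(v ⬝ᵥ b + 1) / (v ⬝ᵥ c))
    rw [div_mul_cancel₀ _ hne] at this
    linarith
  ext i
  by_contra hne
  change c i ≠ 0 at hne
  -- This parameter gives coordinate `i` the value `v ⬝ᵥ b / ε + 1`, just beyond the allowed bound.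
  have := hle _ (subset_closure (hc ((v ⬝ᵥ b / ε + 1 - b i) / c i))) i
  rw [dotProduct_add, dotProduct_smul, hvc, smul_zero, add_zero, Pi.add_apply, Pi.smul_apply,
    smul_eq_mul, div_mul_cancel₀ _ hne, add_sub_cancel] at this
  have h2 := mul_le_mul_of_nonneg_left (le_abs_self (v ⬝ᵥ b / ε + 1)) hε.le
  rw [mul_add, mul_div_cancel₀ _ hε.ne'] at h2
  linarith

theorem isCompact_slice {S : Set (ι → ℝ)} (hv : v ∈ interior (dualCone S)) :
    IsCompact {k ∈ closure S | v ⬝ᵥ k = 1} := by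
  obtain ⟨ε, hε, hle⟩ := exists_pos_forall_mul_abs_le hv
  have hcl : IsClosed {k ∈ closure S | v ⬝ᵥ k = 1} :=
    isClosed_closure.inter (isClosed_eq (by unfold dotProduct; fun_prop) continuous_const)
  refine Metric.isCompact_of_isClosed_isBounded hcl ?_
  refine (Metric.isBounded_closedBall (x := (0 : ι → ℝ)) (r := ε⁻¹)).subset ?_
  rintro k ⟨hk, hvk⟩
  rw [mem_closedBall_zero_iff, pi_norm_le_iff_of_nonneg (inv_nonneg.2 hε.le)]
  intro i
  have := hle k hk i
  rw [hvk] at this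
  rw [Real.norm_eq_abs, ← one_div, le_div_iff₀ hε]
  linarith

theorem IsHyperbolic.gradient_dotProduct_pos (h : IsHyperbolic p a) (hp : p.IsHomogeneous d)
    (hv : v ∈ interior (dualCone (hyperbolicityCone p a))) (hb : b ∈ hyperbolicityCone p a)
    (hx : x ∈ closure (hyperbolicityCone p a)) (hx0 : x ≠ 0) : 0 < gradient p b ⬝ᵥ x := by
  have hB := h.of_mem hp hb
  obtain ⟨m, rfl, hroot, hf, hg⟩ := hB.exists_roots hp x
  rw [← h.hyperbolicityCone_eq hp hb] at hx
  have hm : ∀ w ∈ m, 0 ≤ w := fun w hw => hB.root_nonneg_of_mem_closure hp hx (hroot w hw)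
  rw [hg]
  refine mul_pos hB.1 (lt_of_le_of_ne (Multiset.sum_nonneg hm) fun h0 => hx0 ?_)
  have hm0 : ∀ w ∈ m, w = 0 := fun w hw =>
    le_antisymm (h0 ▸ Multiset.single_le_sum hm w hw) (hm w hw)
  refine eq_zero_of_forall_add_smul_mem hv (h.add_smul_mem hp hb fun t s => ?_)
  rw [hf]
  congr 1
  rw [Multiset.map_congr (g := fun _ => t) rfl fun w hw => by rw [hm0 w hw, mul_zero, add_zero],
    Multiset.map_const', Multiset.prod_replicate]

theorem IsHyperbolic.gradient_mem_interior_dualCone (h : IsHyperbolic p a)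
    (hp : p.IsHomogeneous d) (hne : (interior (dualCone (hyperbolicityCone p a))).Nonempty)
    (hb : b ∈ hyperbolicityCone p a) :
    gradient p b ∈ interior (dualCone (hyperbolicityCone p a)) := by
  obtain ⟨v, hv⟩ := hne
  obtain ⟨ε, hε, hle⟩ := exists_pos_forall_mul_abs_le hv
  -- Positivity on the compact slice has a uniform margin `δ`; scaling back gives `gradient p b ⬝ᵥ k
  -- ≥ δ (v ⬝ᵥ k) ≥ δ ε |k i|`.
  obtain ⟨δ, hδ, hmin⟩ := (isCompact_slice hv).exists_forall_le'
    (f := fun k => gradient p b ⬝ᵥ k) (by unfold dotProduct; fun_prop) (a := 0)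
    fun k hk => h.gradient_dotProduct_pos hp hv hb hk.1 fun h0 => by
      have := hk.2
      rw [h0, dotProduct_zero] at this
      exact zero_ne_one this
  refine mem_interior_dualCone (mul_pos hδ hε) fun k hk i => ?_
  have hvk : 0 ≤ v ⬝ᵥ k := interior_subset hv k hk
  rcases hvk.eq_or_lt with h0 | h0
  · have hk0 : k = 0 := by
      ext j
      have := hle k (subset_closure hk) j
      rw [← h0] at this
      exact abs_nonpos_iff.1 (by nlinarith [abs_nonneg (k j)])
    simp [hk0]
  · have := hmin ((v ⬝ᵥ k)⁻¹ • k)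
      ⟨subset_closure (smul_mem_hyperbolicityCone hp hk (inv_pos.2 h0)), by
        rw [dotProduct_smul, smul_eq_mul, inv_mul_cancel₀ h0.ne']⟩
    simp only [dotProduct_smul, smul_eq_mul] at this
    rw [inv_mul_eq_div, le_div_iff₀ h0] at this
    calc δ * ε * |k i| = δ * (ε * |k i|) := mul_assoc _ _ _
      _ ≤ δ * (v ⬝ᵥ k) := mul_le_mul_of_nonneg_left (hle k (subset_closure hk) i) hδ.le
      _ ≤ _ := this

/-- The common gradient is paired with `x` in two ways: at `b` it gives `p(b)` times the sum of the
roots, and at `x` Euler's identity gives `d p(x)`, which is `d p(b)` times their product. -/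
theorem IsHyperbolic.exists_roots_of_gradient_eq (h : IsHyperbolic p a) (hp : p.IsHomogeneous d)
    (hb : b ∈ hyperbolicityCone p a) (hx : x ∈ hyperbolicityCone p a)
    (hg : gradient p b = gradient p x) :
    ∃ m : Multiset ℝ, m.card = d ∧ (∀ w ∈ m, 0 < w) ∧ m.sum = m.card * m.prod ∧
      ∀ t s : ℝ, eval (t • b + s • x) p = eval b p * (m.map fun w => t + s * w).prod := by
  have hB := h.of_mem hp hb
  obtain ⟨m, hm, hroot, hf, hsum⟩ := hB.exists_roots hp x
  rw [← h.hyperbolicityCone_eq hp hb] at hx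
  refine ⟨m, hm, fun w hw => root_pos_of_mem_hyperbolicityCone hx (hroot w hw), ?_, hf⟩
  rw [hg, hp.gradient_dotProduct_self] at hsum
  have := hf 0 1
  simp only [zero_smul, one_smul, zero_add, one_mul, Multiset.map_id'] at this
  rw [this, mul_left_comm] at hsum
  rw [hm]
  exact (mul_left_cancel₀ hB.1.ne' hsum).symm

theorem IsHyperbolic.eval_le_of_gradient_eq (h : IsHyperbolic p a) (hp : p.IsHomogeneous d)
    (hd : 2 ≤ d) (hb : b ∈ hyperbolicityCone p a) (hx : x ∈ hyperbolicityCone p a)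
    (hg : gradient p b = gradient p x) : eval b p ≤ eval x p := by
  obtain ⟨m, hm, hpos, hsum, hf⟩ := h.exists_roots_of_gradient_eq hp hb hx hg
  have := hf 0 1
  simp only [zero_smul, one_smul, zero_add, one_mul, Multiset.map_id'] at this
  rw [this]
  exact le_mul_of_one_le_right (h.eval_pos_of_mem hp hb).le
    (Multiset.one_le_prod_of_sum_eq hpos (hm ▸ hd) hsum)

theorem IsHyperbolic.injOn_gradient (h : IsHyperbolic p a) (hp : p.IsHomogeneous d) (hd : 2 ≤ d)
    (hne : (interior (dualCone (hyperbolicityCone p a))).Nonempty) :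
    Set.InjOn (gradient p) (hyperbolicityCone p a) := by
  intro b hb x hx hg
  obtain ⟨v, hv⟩ := hne
  obtain ⟨m, rfl, hpos, hsum, hf⟩ := h.exists_roots_of_gradient_eq hp hb hx hg
  have heq : eval x p = eval b p :=
    (h.eval_le_of_gradient_eq hp hd hx hb hg.symm).antisymm
      (h.eval_le_of_gradient_eq hp hd hb hx hg)
  have h1 := hf 0 1
  simp only [zero_smul, one_smul, zero_add, one_mul, Multiset.map_id'] at h1
  have hprod : m.prod = 1 := by
    rw [heq] at h1
    exact mul_left_cancel₀ (h.eval_pos_of_mem hp hb).ne' (by rw [mul_one]; exact h1.symm)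
  rw [hprod, mul_one] at hsum
  have hone := Multiset.eq_one_of_prod_eq_one_of_sum_eq hpos hprod hsum
  refine (sub_eq_zero.1 (eq_zero_of_forall_add_smul_mem hv
    (h.add_smul_mem hp hb fun t s => ?_) : x - b = 0)).symm
  -- With all roots equal to `1`, each factor becomes `(t - s) + s = t`.
  have : t • b + s • (x - b) = (t - s) • b + s • x := by rw [smul_sub, sub_smul]; abel
  rw [this, hf]
  congr 1
  rw [Multiset.map_congr (g := fun _ => t) rfl fun w hw => by
      rw [hone w hw, mul_one, sub_add_cancel],
    Multiset.map_const', Multiset.prod_replicate]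

theorem IsHyperbolic.surjOn_gradient (h : IsHyperbolic p a) (hp : p.IsHomogeneous d)
    (hd : 2 ≤ d) :
    Set.SurjOn (gradient p) (hyperbolicityCone p a)
      (interior (dualCone (hyperbolicityCone p a))) := by
  classical
  intro v hv
  obtain ⟨ε, hε, hle⟩ := exists_pos_forall_mul_abs_le hv
  have haC := h.self_mem hp
  have hva : 0 < v ⬝ᵥ a := by
    refine lt_of_le_of_ne (interior_subset hv a haC) fun h0 => ?_
    have ha0 : a = 0 := by
      ext j
      have := hle a (subset_closure haC) j
      rw [← h0] at this
      exact abs_nonpos_iff.1 (by nlinarith [abs_nonneg (a j)])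
    have := h.1
    rw [ha0, ← zero_smul ℝ (0 : ι → ℝ), hp.eval_smul, zero_pow (by omega), zero_mul] at this
    exact lt_irrefl _ this
  have ha' := smul_mem_hyperbolicityCone hp haC (inv_pos.2 hva)
  have haK : (v ⬝ᵥ a)⁻¹ • a ∈ {k ∈ closure (hyperbolicityCone p a) | v ⬝ᵥ k = 1} :=
    ⟨subset_closure ha', by rw [dotProduct_smul, smul_eq_mul, inv_mul_cancel₀ hva.ne']⟩
  obtain ⟨k, ⟨hk, hvk⟩, hmax⟩ := (isCompact_slice hv).exists_isMaxOn ⟨_, haK⟩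
    (continuous_eval p).continuousOn
  -- The normalized `a` lies on the slice, so the maximum is positive and is not attained at a
  -- boundary point, where `p` vanishes.
  have hkpos : 0 < eval k p := (h.eval_pos_of_mem hp ha').trans_le (hmax haK)
  have hkC := h.mem_of_mem_closure hp hk hkpos.ne'
  have hcrit : ∀ y : ι → ℝ, v ⬝ᵥ y = 0 → gradient p k ⬝ᵥ y = 0 := by
    intro y hy
    refine IsLocalMax.hasDerivAt_eq_zero ?_ (hasDerivAt_eval_add_smul p k y)
    have hcont : Continuous fun s : ℝ => k + s • y := by fun_prop
    have hev : ∀ᶠ s in nhds (0 : ℝ), k + s • y ∈ hyperbolicityCone p a :=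
      hcont.continuousAt.eventually_mem
        ((isOpen_hyperbolicityCone hp h.1.ne').mem_nhds (by simpa using hkC))
    filter_upwards [hev] with s hs
    have := hmax (a := k + s • y) ⟨subset_closure hs, by
      rw [dotProduct_add, dotProduct_smul, hy, hvk, smul_zero, add_zero]⟩
    simpa using this
  have hgrad : gradient p k = (d * eval k p) • v := by
    ext i
    -- Since `v ⬝ᵥ k = 1`, this is the projection of `eᵢ` along `k` to the kernel of `v`; Euler's
    -- identity then identifies the multiplier as `d p(k)`.
    have := hcrit (Pi.single i 1 - v i • k) (by
      rw [dotProduct_sub, dotProduct_single, dotProduct_smul, hvk]; simp)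
    rw [dotProduct_sub, dotProduct_single, dotProduct_smul, hp.gradient_dotProduct_self,
      mul_one, sub_eq_zero] at this
    rw [this, Pi.smul_apply, smul_eq_mul, smul_eq_mul, mul_comm]
  have hd0 : (0 : ℝ) < d := by exact_mod_cast (by omega : 0 < d)
  have hc : 0 < (d * eval k p)⁻¹ := inv_pos.2 (mul_pos hd0 hkpos)
  -- The gradient is homogeneous of degree `d - 1`, so a root of that order removes the factor `d
  -- p(k)`.
  refine ⟨((d * eval k p)⁻¹ ^ ((d - 1 : ℕ) : ℝ)⁻¹) • k,
    smul_mem_hyperbolicityCone hp hkC (Real.rpow_pos_of_pos hc _), ?_⟩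
  rw [hp.gradient_smul, Real.rpow_inv_natCast_pow hc.le (by omega), hgrad, smul_smul,
    inv_mul_cancel₀ (mul_pos hd0 hkpos).ne', one_smul]

/-- The gradient of a hyperbolic polynomial of degree at least two maps the hyperbolicity cone
bijectively onto the interior of its dual cone, provided that this interior is nonempty. -/
theorem IsHyperbolic.bijOn_gradient (h : IsHyperbolic p a) (hp : p.IsHomogeneous d) (hd : 2 ≤ d)
    (hne : (interior (dualCone (hyperbolicityCone p a))).Nonempty) :
    Set.BijOn (gradient p) (hyperbolicityCone p a)
      (interior (dualCone (hyperbolicityCone p a))) :=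
  ⟨fun _ hb => h.gradient_mem_interior_dualCone hp hne hb, h.injOn_gradient hp hd hne,
    h.surjOn_gradient hp hd⟩

end Bijection

end MvPolynomial

/-! ### The Fresnel polynomial of an area metric as a hyperbolic quartic. -/

namespace AreaMetric

open MvPolynomial

section Frame

variable {V : Type*} [AddCommGroup V] [Module ℝ V]
  (G : AreaMetric V) (e : Module.Basis (Fin 4) ℝ V)

theorem isHomogeneous_fresnelPoly : (G.fresnelPoly e).IsHomogeneous 4 := by
  rw [fresnelPoly]
  refine IsHomogeneous.sum _ _ _ fun a _ => IsHomogeneous.sum _ _ _ fun b _ =>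
    IsHomogeneous.sum _ _ _ fun c _ => IsHomogeneous.sum _ _ _ fun d _ => ?_
  change IsHomogeneous _ (1 + 1 + 1 + 1)
  exact ((((isHomogeneous_X ℝ a).mul (isHomogeneous_X ℝ b)).mul (isHomogeneous_X ℝ c)).mul
    (isHomogeneous_X ℝ d)).C_mul _

/-- The Fresnel tensor is totally symmetric. -/
theorem fresnelComp_eq_of_comp_perm {a b c d a' b' c' d' : Fin 4} (π : Equiv.Perm (Fin 4))
    (h : ![a', b', c', d'] = ![a, b, c, d] ∘ π) :
    G.fresnelComp e a' b' c' d' = G.fresnelComp e a b c d := by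
  rw [fresnelComp, fresnelComp, h]
  refine congrArg (fun y : ℝ => 1 / 24 * y) ?_
  refine Fintype.sum_equiv (Equiv.mulLeft π) _ _ fun σ => ?_
  rw [Equiv.coe_mulLeft, Equiv.Perm.coe_mul, Function.comp_assoc]

theorem fresnelComp_swap_two_three (a b c d : Fin 4) :
    G.fresnelComp e a b d c = G.fresnelComp e a b c d :=
  G.fresnelComp_eq_of_comp_perm e (Equiv.swap 2 3) (by ext i; fin_cases i <;> rfl)

theorem fresnelComp_swap_one_two (a b c d : Fin 4) :
    G.fresnelComp e a c b d = G.fresnelComp e a b c d :=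
  G.fresnelComp_eq_of_comp_perm e (Equiv.swap 1 2) (by ext i; fin_cases i <;> rfl)

theorem fresnelComp_swap_zero_one (a b c d : Fin 4) :
    G.fresnelComp e b a c d = G.fresnelComp e a b c d :=
  G.fresnelComp_eq_of_comp_perm e (Equiv.swap 0 1) (by ext i; fin_cases i <;> rfl)

/-- Total symmetry makes the four terms of the Leibniz rule equal, whence the factor `4`. -/
theorem gradient_fresnelPoly (x : Fin 4 → ℝ) (d : Fin 4) :
    MvPolynomial.gradient (G.fresnelPoly e) x d =
      4 * ∑ a, ∑ b, ∑ c, G.fresnelComp e a b c d * x a * x b * x c := by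
  have h1 : ∀ a b c : Fin 4, G.fresnelComp e a b d c = G.fresnelComp e a b c d :=
    fun a b c => G.fresnelComp_swap_two_three e a b c d
  have h2 : ∀ a b c : Fin 4, G.fresnelComp e a d b c = G.fresnelComp e a b c d :=
    fun a b c => (G.fresnelComp_swap_one_two e a b d c).trans (h1 a b c)
  have h3 : ∀ a b c : Fin 4, G.fresnelComp e d a b c = G.fresnelComp e a b c d :=
    fun a b c => (G.fresnelComp_swap_zero_one e a d b c).trans (h2 a b c)
  have hterm : ∀ a b c k : Fin 4,
      eval x (pderiv d (C (G.fresnelComp e a b c k) * (X a * X b * X c * X k))) =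
        (if a = d then G.fresnelComp e a b c k * x b * x c * x k else 0) +
        (if b = d then G.fresnelComp e a b c k * x a * x c * x k else 0) +
        (if c = d then G.fresnelComp e a b c k * x a * x b * x k else 0) +
        (if k = d then G.fresnelComp e a b c k * x a * x b * x c else 0) := by
    intro a b c k
    have hX : ∀ i : Fin 4, eval x (pderiv d (X i : MvPolynomial (Fin 4) ℝ)) =
        if i = d then 1 else 0 := fun i => by
      rw [pderiv_X, Pi.single_apply, apply_ite (eval x), map_one, map_zero]
    rw [pderiv_C_mul]
    simp only [pderiv_mul, map_mul, map_add, eval_C, eval_X, hX]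
    split_ifs <;> ring
  simp only [MvPolynomial.gradient, fresnelPoly, map_sum, hterm, Finset.sum_add_distrib,
    Finset.sum_ite_irrel, Finset.sum_const_zero, Finset.sum_ite_eq', Finset.mem_univ, if_true,
    h1, h2, h3]
  ring

end Frame

section Cones

variable {V : Type*} [AddCommGroup V] [Module ℝ V] [TopologicalSpace V]
  (G : AreaMetric V) (e : Module.Basis (Fin 4) ℝ V)

theorem eval_fresnelPoly (k : V →L[ℝ] ℝ) :
    eval (fun i => k (e i)) (G.fresnelPoly e) = G.fresnel e k k k k := by
  simp only [fresnelPoly, fresnel, map_sum, map_mul, eval_C, eval_X, ← mul_assoc]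

theorem gradient_C_mul_fresnelPoly (r : ℝ) (k : V →L[ℝ] ℝ) :
    e.equivFun.symm (MvPolynomial.gradient (C (r / 4) * G.fresnelPoly e) fun i => k (e i)) =
      r • G.fresnelMap e k := by
  rw [e.equivFun_symm_apply, fresnelMap, Finset.smul_sum]
  refine Finset.sum_congr rfl fun d _ => ?_
  rw [smul_smul]
  congr 1
  have := G.gradient_fresnelPoly e (fun i => k (e i)) d
  simp only [MvPolynomial.gradient] at this ⊢
  rw [pderiv_C_mul, map_mul, eval_C, this]
  ring

variable {G e} {τ : V →L[ℝ] ℝ} {r : ℝ}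

theorem IsTimelike.charPoly_factor_ne_zero (h : G.IsTimelike e τ) :
    -(|(G.petrov e).det| ^ (-(1 / 3) : ℝ)) ≠ 0 := by
  intro h0
  apply h.1
  rw [charValue, charPoly, h0, C_0, zero_mul, map_zero]

theorem IsTimelike.charValue_eq_zero_iff (h : G.IsTimelike e τ) (hr : r ≠ 0) (k : V →L[ℝ] ℝ) :
    G.charValue e k = 0 ↔ eval (fun i => k (e i)) (C r * G.fresnelPoly e) = 0 := by
  rw [charValue, charPoly, map_mul, map_mul, eval_C, eval_C, mul_eq_zero, mul_eq_zero,
    or_iff_right h.charPoly_factor_ne_zero, or_iff_right hr]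

theorem IsTimelike.fresnel_ne_zero (h : G.IsTimelike e τ) : G.fresnel e τ τ τ τ ≠ 0 := by
  rw [← eval_fresnelPoly]
  intro h0
  exact h.1 ((h.charValue_eq_zero_iff one_ne_zero τ).2 (by rw [map_mul, h0, mul_zero]))

/-- Only the zeros of `P` enter, so any nonzero multiple of the Fresnel polynomial gives the same
cone; the root variable changes sign. The sign of `r` matters only for hyperbolicity. -/
theorem IsTimelike.futureCovectorCone_eq (h : G.IsTimelike e τ) (hr : r ≠ 0) :
    G.futureCovectorCone e τ = (fun (k : V →L[ℝ] ℝ) i => k (e i)) ⁻¹'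
      hyperbolicityCone (C r * G.fresnelPoly e) fun i => τ (e i) := by
  ext ξ
  have key : ∀ s : ℝ, (fun i => ξ (e i)) + s • (fun i => τ (e i)) =
      fun i => (ξ - (-s) • τ) (e i) := fun s => by
    ext i; simp
  simp only [futureCovectorCone, Set.mem_ofPred_eq, Set.mem_preimage, hyperbolicityCone, key]
  constructor
  · intro hξ s hs h0
    have := hξ (-s) ((h.charValue_eq_zero_iff hr _).2 h0)
    linarith
  · intro hξ s hs
    by_contra hlt
    refine hξ (-s) (by linarith) ?_
    rw [neg_neg]
    exact (h.charValue_eq_zero_iff hr _).1 hs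

variable [IsTopologicalAddGroup V] [ContinuousSMul ℝ V] [T2Space V]

theorem exists_covector_of_components (e : Module.Basis (Fin 4) ℝ V) (x : Fin 4 → ℝ) :
    ∃ k : V →L[ℝ] ℝ, (fun i => k (e i)) = x := by
  have := Module.Finite.of_basis e
  exact ⟨LinearMap.toContinuousLinearMap (e.constr ℝ x), by ext i; simp [e.constr_basis]⟩

theorem IsTimelike.isHyperbolic (h : G.IsTimelike e τ) (hr : 0 < r * G.fresnel e τ τ τ τ) :
    IsHyperbolic (C r * G.fresnelPoly e) fun i => τ (e i) := by
  refine ⟨by rwa [map_mul, eval_C, eval_fresnelPoly], fun x z hz => ?_⟩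
  obtain ⟨η, rfl⟩ := exists_covector_of_components e x
  have hr0 : (r : ℂ) ≠ 0 := by
    have : r ≠ 0 := by rintro rfl; simp at hr
    exact_mod_cast this
  rw [map_mul, aeval_C] at hz
  have h0 := (mul_eq_zero.1 hz).resolve_left hr0
  have := h.2 η (-z) (by
    rw [charPoly, map_mul, mul_eq_zero]
    right
    convert h0 using 3
    ext i
    simp)
  simpa using this

theorem IsTimelike.isOpen_futureCovectorCone (h : G.IsTimelike e τ) :
    IsOpen (G.futureCovectorCone e τ) := by
  have hne := h.fresnel_ne_zero
  -- Multiplying by `𝒢(τ,τ,τ,τ)` itself makes the value at `τ` a square, which treats both signs at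
  -- once.
  have hh := h.isHyperbolic (mul_self_pos.2 hne)
  rw [h.futureCovectorCone_eq hne]
  refine (isOpen_hyperbolicityCone ((G.isHomogeneous_fresnelPoly e).C_mul _) hh.1.ne').preimage ?_
  exact continuous_pi fun i => continuous_eval_const (e i)

theorem IsTimelike.convex_futureCovectorCone (h : G.IsTimelike e τ) :
    Convex ℝ (G.futureCovectorCone e τ) := by
  have hne := h.fresnel_ne_zero
  have hh := h.isHyperbolic (mul_self_pos.2 hne)
  rw [h.futureCovectorCone_eq hne]
  exact (hh.convex_hyperbolicityCone ((G.isHomogeneous_fresnelPoly e).C_mul _)).is_linear_preimage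
    ⟨fun _ _ => rfl, fun _ _ => rfl⟩

omit [IsTopologicalAddGroup V] [ContinuousSMul ℝ V] [T2Space V] in
theorem IsTimelike.smul_mem_futureCovectorCone (h : G.IsTimelike e τ) {k : V →L[ℝ] ℝ}
    (hk : k ∈ G.futureCovectorCone e τ) {s : ℝ} (hs : 0 < s) :
    s • k ∈ G.futureCovectorCone e τ := by
  rw [h.futureCovectorCone_eq h.fresnel_ne_zero] at hk ⊢
  exact smul_mem_hyperbolicityCone ((G.isHomogeneous_fresnelPoly e).C_mul _) hk hs

theorem IsTimelike.futureVectorCone_eq (h : G.IsTimelike e τ) (hr : r ≠ 0) :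
    G.futureVectorCone e τ = e.equivFun ⁻¹' interior
      (dualCone (hyperbolicityCone (C r * G.fresnelPoly e) fun i => τ (e i))) := by
  have := Module.Finite.of_basis e
  have hpre := e.equivFunL.toHomeomorph.preimage_interior
    (dualCone (hyperbolicityCone (C r * G.fresnelPoly e) fun i => τ (e i)))
  refine Eq.trans ?_ hpre.symm
  rw [futureVectorCone, h.futureCovectorCone_eq hr]
  congr 1
  ext v
  have hpair : ∀ k : V →L[ℝ] ℝ, k v = e.equivFun v ⬝ᵥ fun i => k (e i) := fun k => by
    conv_lhs => rw [← e.sum_equivFun v]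
    simp only [map_sum, map_smul, smul_eq_mul, dotProduct]
  constructor
  · intro hv x hx
    obtain ⟨k, rfl⟩ := exists_covector_of_components e x
    exact (hpair k) ▸ hv k hx
  · intro hv k hk
    rw [hpair]
    exact hv _ hk

/-- The gradient bijection is applied to `(r/4)𝒢`, whose gradient is `r𝒢(k,k,k,·)`; the two cases of
the theorem are `r = 1` and `r = -1`. -/
theorem IsTimelike.bijOn_smul_fresnelMap (h : G.IsTimelike e τ)
    (hr : 0 < r * G.fresnel e τ τ τ τ) (hne : (G.futureVectorCone e τ).Nonempty) :
    Set.BijOn (fun k => r • G.fresnelMap e k) (G.futureCovectorCone e τ)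
      (G.futureVectorCone e τ) := by
  have hr4 : 0 < r / 4 * G.fresnel e τ τ τ τ := by
    rw [div_mul_eq_mul_div]; positivity
  have hr0 : r / 4 ≠ 0 := left_ne_zero_of_mul hr4.ne'
  rw [h.futureVectorCone_eq hr0] at hne ⊢
  rw [h.futureCovectorCone_eq hr0]
  simp only [← gradient_C_mul_fresnelPoly]
  obtain ⟨v, hv⟩ := hne
  obtain ⟨hmaps, hinj, hsurj⟩ := (h.isHyperbolic hr4).bijOn_gradient
    ((G.isHomogeneous_fresnelPoly e).C_mul _) (by norm_num) ⟨_, hv⟩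
  refine ⟨fun k hk => ?_, fun k hk l hl hkl => ?_, fun w hw => ?_⟩
  · rw [Set.mem_preimage, LinearEquiv.apply_symm_apply]
    exact hmaps hk
  · have := hinj hk hl (e.equivFun.symm.injective hkl)
    exact ContinuousLinearMap.coe_injective (e.ext fun i => congrFun this i)
  · obtain ⟨x, hx, hxw⟩ := hsurj hw
    obtain ⟨k, rfl⟩ := exists_covector_of_components e x
    exact ⟨k, hx, (e.equivFun.symm_apply_eq).2 hxw⟩

end Cones

end AreaMetric

theorem theorem2p1 (M : Type*) [TopologicalSpace M] [ChartedSpace (EuclideanSpace ℝ (Fin 4)) M]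
    [IsManifold (𝓡 4) ∞ M] (G : AreaMetricField M)
    (τ : ∀ p : M, TangentSpace (𝓡 4) p →L[ℝ] ℝ) (hτ : IsTimeOrientation G τ)
    (p : M) (e : Module.Basis (Fin 4) ℝ (TangentSpace (𝓡 4) p)) :
    IsOpen ((G.at_ p).futureCovectorCone e (τ p)) ∧
    Convex ℝ ((G.at_ p).futureCovectorCone e (τ p)) ∧
    (∀ k ∈ (G.at_ p).futureCovectorCone e (τ p), ∀ s : ℝ, 0 < s →
      s • k ∈ (G.at_ p).futureCovectorCone e (τ p)) ∧
    (((G.at_ p).futureVectorCone e (τ p)).Nonempty →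
      (0 < (G.at_ p).fresnel e (τ p) (τ p) (τ p) (τ p) →
        Set.BijOn ((G.at_ p).fresnelMap e) ((G.at_ p).futureCovectorCone e (τ p))
          ((G.at_ p).futureVectorCone e (τ p))) ∧
      ((G.at_ p).fresnel e (τ p) (τ p) (τ p) (τ p) < 0 →
        Set.BijOn (fun k => -(G.at_ p).fresnelMap e k) ((G.at_ p).futureCovectorCone e (τ p))
          ((G.at_ p).futureVectorCone e (τ p)))) := by
  have h := hτ.2 p e
  have : T2Space (TangentSpace (𝓡 4) p) :=
    inferInstanceAs (T2Space (EuclideanSpace ℝ (Fin 4)))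
  refine ⟨h.isOpen_futureCovectorCone, h.convex_futureCovectorCone,
    fun k hk s hs => h.smul_mem_futureCovectorCone hk hs, fun hne => ⟨fun hpos => ?_, fun hneg => ?_⟩⟩
  · simpa only [one_smul] using h.bijOn_smul_fresnelMap (r := 1) (by rwa [one_mul]) hne
  · simpa only [neg_smul, one_smul] using h.bijOn_smul_fresnelMap (r := -1) (by linarith) hne
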